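/- **Setting.** There are $K\ge 2$ arms and $L\ge 1$ resources with budgets $C_1,\dots,C_L$. Pulling arm $k$ returns an outcome, consisting of a reward and of the consumed amounts of the $L$ resources, drawn from a distribution $\nu_k$ unknown to the agent. A strategy $(\pi,\tau,\psi)$ consists of a policy $\pi$ that selects each arm as a function of the previous outcomes, a stopping time $\tau$ (the number of pulls) for the filtration generated by the outcomes, and a recommended arm $\psi\in\{1,\dots,K\}$ determined by the outcomes up to time $\tau$. It is required that $\tau<\infty$ almost surely and that the total consumption of each resource $\ell$ up to $\tau$ is almost surely at most $C_\ell$. Let $\frac12=r_1>r_2\ge\dots\ge r_K=\frac14$ and $\Delta_k=r_1-r_k$, let $d^0_{\ell,(1)}\ge\dots\ge d^0_{\ell,(K)}>0$ for $\ell=1,\dots,L$, and fix $i\in\{2,\dots,K\}$. For $c>0$ put $d_{\ell,(k)}=c\,d^0_{\ell,(k)}$ and, if these numbers lie in $[0,1]$, define instances $Q^{(j)}$, $j=1,\dots,K$, as follows. A pull of arm $k$ has a reward distributed as $\mathcal N(r^{(j)}_k,1)$, with $r^{(j)}_k=r_k$ for $k\ne j$ and $r^{(j)}_j=1-r_j$,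 and consumes $\mathrm{Bern}(d_{\ell,k})$ units of resource $\ell$, with $d_{\ell,1}=d_{\ell,(2)}$, $d_{\ell,2}=d_{\ell,(1)}$ and $d_{\ell,k}=d_{\ell,(k)}$ for $k\ge3$; the reward and the $L$ consumptions are independent. For a function $g$ put $$\tilde\gamma_g=\min_{\ell\in\{1,\dots,L\}}\frac{C_\ell}{\tilde H_\ell},\qquad \tilde H_\ell=\max_{2\le k\le K}\frac{\sum_{j=1}^k g(d_{\ell,(j)})}{\Delta_k^2}.$$ **Theorem.** (1) Let $g:[0,\infty)\to[0,\infty)$ be increasing with $g(0)=0$ and $\lim_{d\to0^+}\frac{1}{g(d)\log(1/d)}=+\infty$. Then there is $\bar c\in(0,1)$ such that for every $c\in(0,\bar c)$ all $d_{\ell,(k)}$ lie in $[0,1]$ and, whenever $C_1,\dots,C_L$ are all larger than some threshold, which does not depend on the strategy, every strategy that meets the above requirements under $Q^{(1)}$ and $Q^{(i)}$ satisfies $$\max_{j\in\{1,i\}}\Pr_{Q^{(j)}}(\psi\ne j)\ \ge\ \exp(-2\tilde\gamma_g).$$ (2) Hence the effective consumption of order $1/\log(1/d)$ cannot be improved to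 $d$ or to $(\log(1/d))^{-1-\varepsilon}$: let $g(d)=d$, or $g(d)=(\log(1/d))^{-1-\varepsilon}$ with $\varepsilon>0$, and let $A,B>0$ be arbitrary constants. Then there is $\bar c\in(0,1)$ such that for every $c\in(0,\bar c)$ all $d_{\ell,(k)}$ lie in $[0,1]$ and, whenever $C_1,\dots,C_L$ are all larger than some threshold, which does not depend on the strategy, every strategy as in (1) satisfies $$\max_{j\in\{1,i\}}\Pr_{Q^{(j)}}(\psi\ne j)\ >\ A\exp(-B\,\tilde\gamma_g).$$ -/

import Mathlib

open MeasureTheory ProbabilityTheory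
open scoped unitInterval

noncomputable section

namespace BAIwRC

/-- What one arm pull returns: the reward, and the amount consumed of each of the `L` resources. -/
abbrev Outcome (L : ℕ) : Type := ℝ × (Fin L → ℝ)

/-- The history `H(t)`: the σ-algebra generated by the first `t` outcomes. The outcome of the
time step `t + 1` is the coordinate `ω t`. -/
def history (L : ℕ) :
    Filtration ℕ (inferInstance : MeasurableSpace (ℕ → Outcome L)) where
  seq t := MeasurableSpace.comap (fun (ω : ℕ → Outcome L) (s : Fin t) => ω s) inferInstance
  mono' := by
    intro a b hab
    have h : (fun (ω : ℕ → Outcome L) (s : Fin a) => ω s) =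
        (fun (v : Fin b → Outcome L) (s : Fin a) => v (Fin.castLE hab s)) ∘
          (fun (ω : ℕ → Outcome L) (s : Fin b) => ω s) := by
      funext ω s
      rfl
    change MeasurableSpace.comap _ _ ≤ _
    rw [h, ← MeasurableSpace.comap_comp]
    apply MeasurableSpace.comap_mono
    apply Measurable.comap_le
    fun_prop
  le' := by
    intro t
    apply Measurable.comap_le
    fun_prop

/-- A strategy `(π, τ, ψ)` for `K` arms and `L` resources. -/
structure Strategy (K L : ℕ) where
  /-- the policy: `arm t h` is the arm pulled at time step `t + 1`, after the outcomes `h` -/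
  arm : (t : ℕ) → (Fin t → Outcome L) → Fin K
  measurable_arm : ∀ t, Measurable (arm t)
  /-- the number `τ` of arm pulls -/
  tau : (ℕ → Outcome L) → WithTop ℕ
  isStoppingTime_tau : IsStoppingTime (history L) tau
  /-- the recommended arm `ψ`, which is determined by the history up to `τ` -/
  guess : (ℕ → Outcome L) → Fin K
  measurable_guess : Measurable[isStoppingTime_tau.measurableSpace] guess

variable {K L : ℕ}

/-- The conditional law of the outcome of time step `n + 2` given the first `n + 1` outcomes, when
the arms are chosen by `s` and arm `k` has the outcome distribution `ν k`. -/
def stepKernel (ν : Fin K → Measure (Outcome L)) (s : Strategy K L) (n : ℕ) :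
    Kernel ((_ : Finset.Iic n) → Outcome L) (Outcome L) :=
  (Kernel.ofFunOfCountable ν).comap
    (fun h => s.arm (n + 1)
      (fun t => h ⟨t, Finset.mem_Iic.2 (Nat.le_of_lt_succ t.isLt)⟩))
    ((s.measurable_arm (n + 1)).comp (by fun_prop))

instance (ν : Fin K → Measure (Outcome L)) [∀ k, IsProbabilityMeasure (ν k)]
    (s : Strategy K L) (n : ℕ) : IsMarkovKernel (stepKernel ν s n) := by
  have : IsMarkovKernel (Kernel.ofFunOfCountable ν) := ⟨fun k => inferInstanceAs
    (IsProbabilityMeasure (ν k))⟩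
  unfold stepKernel
  infer_instance

/-- The law of the sequence of outcomes, when the arms are chosen by the strategy `s` and each
pull of arm `k` has the outcome distribution `ν k`. -/
def trajLaw (ν : Fin K → Measure (Outcome L)) [∀ k, IsProbabilityMeasure (ν k)]
    (s : Strategy K L) : Measure (ℕ → Outcome L) :=
  Kernel.trajMeasure (X := fun _ => Outcome L) (ν (s.arm 0 Fin.elim0)) (stepKernel ν s)

/-- Under the arm distributions `ν`, almost surely the strategy `s` makes finitely many pulls and consumes at most
`C ℓ` units of each resource `ℓ`. -/
def Feasible (ν : Fin K → Measure (Outcome L)) [∀ k, IsProbabilityMeasure (ν k)]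
    (C : Fin L → ℝ) (s : Strategy K L) : Prop :=
  ∀ᵐ ω ∂(trajLaw ν s), ∃ n : ℕ, s.tau ω = (n : WithTop ℕ) ∧
    ∀ ℓ, ∑ t ∈ Finset.range n, (ω t).2 ℓ ≤ C ℓ

/-- The probability that the recommended arm is not `j`. -/
def failProb (ν : Fin K → Measure (Outcome L)) [∀ k, IsProbabilityMeasure (ν k)]
    (s : Strategy K L) (j : Fin K) : ℝ :=
  (trajLaw ν s).real {ω | s.guess ω ≠ j}

variable {N : ℕ}

/-- Mean reward of arm `k` in the instance `Q^(j)`. -/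
def meanReward (r : Fin (N + 2) → ℝ) (j k : Fin (N + 2)) : ℝ :=
  if k = j then 1 - r k else r k

/-- Mean consumption of arm `k`, where `d` lists the mean consumptions of one resource in
non-increasing order: the two largest are exchanged. -/
def meanConsumption (d : Fin (N + 2) → I) (k : Fin (N + 2)) : I :=
  if k = 0 then d 1 else if k = 1 then d 0 else d k

/-- Outcome distribution of arm `k` in the instance `Q^(j)`: a Gaussian reward of variance `1` and
Bernoulli consumptions, all independent. -/
def instanceLaw (r : Fin (N + 2) → ℝ) (d : Fin L → Fin (N + 2) → I) (j k : Fin (N + 2)) :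
    Measure (Outcome L) :=
  (gaussianReal (meanReward r j k) 1).prod
    (Measure.pi fun ℓ => bernoulliMeasure (1 : ℝ) 0 (meanConsumption (d ℓ) k))

instance (r : Fin (N + 2) → ℝ) (d : Fin L → Fin (N + 2) → I) (j k : Fin (N + 2)) :
    IsProbabilityMeasure (instanceLaw r d j k) := by
  unfold instanceLaw
  infer_instance

/-- `H̃ = max_{2 ≤ k ≤ K} (g(d_(1)) + ⋯ + g(d_(k))) / Δ_k²` for one resource, with
`Δ_k = r_1 - r_k`; the arm `k` of this formula is the index `m.succ`. -/
def complexityH (g : ℝ → ℝ) (r : Fin (N + 2) → ℝ) (d : Fin (N + 2) → I) : ℝ :=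
  Finset.univ.sup' Finset.univ_nonempty fun m : Fin (N + 1) =>
    (∑ j ∈ Finset.Iic m.succ, g (d j)) / (r 0 - r m.succ) ^ 2

/-- `γ̃ = min_ℓ C_ℓ / H̃_ℓ`. -/
def complexityGamma [NeZero L] (g : ℝ → ℝ) (r : Fin (N + 2) → ℝ)
    (d : Fin L → Fin (N + 2) → I) (C : Fin L → ℝ) : ℝ :=
  Finset.univ.inf' Finset.univ_nonempty fun ℓ : Fin L => C ℓ / complexityH g r (d ℓ)

/-- The mean consumptions `c * d0`, where these are numbers in `[0, 1]`. -/
def scaled (c : ℝ) (d0 : Fin L → Fin (N + 2) → ℝ) (h : ∀ ℓ k, c * d0 ℓ k ∈ I) :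
    Fin L → Fin (N + 2) → I :=
  fun ℓ k => ⟨c * d0 ℓ k, h ℓ k⟩

end BAIwRC

end

/-! A strategy cannot exclude a run in which every pull consumes a full unit of resource `ℓ`. Such a
run must stop after about `C ℓ` pulls, and its probability is only exponentially small in `C ℓ * log
(1 / c)`.

To exploit this, replace every arm by one law `ρ k` with uniform reward on `[0, 1]`, conditioned on
consuming a unit of `ℓ`. It is the same for all instances, and each instance dominates `δ • ρ k`
with `δ` a constant times `c` (`smul_fullConsumptionLaw_le`). On events of the first `n` outcomes
this costs a factor `δ ^ n` (`pow_mul_trajLaw_le`). Under `ρ` the strategy stops almost surely in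
time, and its guess is wrong for at least one of two candidate arms. Hence the two failure
probabilities add up to at least `δ ^ (⌊C ℓ⌋₊ + 1)` (`pow_le_failProb_add_failProb`).

If `g d * log (1 / d) → 0`, then `H̃` is negligible against `1 / log (1 / c)`, so `exp (-B γ̃)` is
eventually smaller than this bound, with room for any factor `A` (`lt_max_failProb_of_tendsto`).
Both parts of the theorem are instances. -/

namespace BAIwRC

/-! ### Domination between laws of trajectories -/

section Trajectory

variable {X : ℕ → Type*} [∀ n, MeasurableSpace (X n)]

/-- The map `f` does not depend on the initial law or the kernels, so two trajectories can be
compared at time zero through the same pushforward. -/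
lemma exists_map_frestrictLe_zero_trajMeasure_eq :
    ∃ f : X 0 → (i : Finset.Iic 0) → X i, Measurable f ∧ (∀ y, f y ⟨0, by simp⟩ = y) ∧
      ∀ (μ₀ : Measure (X 0)) (κ : (n : ℕ) → Kernel ((i : Finset.Iic n) → X i) (X (n + 1)))
        [∀ n, IsMarkovKernel (κ n)],
        (Kernel.trajMeasure μ₀ κ).map (Preorder.frestrictLe 0) = μ₀.map f := by
  refine ⟨(MeasurableEquiv.piUnique fun i : Finset.Iic 0 => X i).symm,
    (MeasurableEquiv.piUnique fun i : Finset.Iic 0 => X i).symm.measurable, fun y => ?_,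
    fun μ₀ κ _ => ?_⟩
  · exact (MeasurableEquiv.piUnique fun i : Finset.Iic 0 => X i).apply_symm_apply y
  · rw [Kernel.trajMeasure, Measure.map_comp _ _ (by fun_prop), Kernel.traj_map_frestrictLe,
      Kernel.partialTraj_self, Measure.id_comp]
    rfl

/-- If the initial law and the transition kernels dominate `δ` times those of another trajectory,
then the law of the first `n + 1` points dominates `δ ^ (n + 1)` times that of the other one. -/
lemma trajMeasure_frestrictLe_le {μ₀ μ₀' : Measure (X 0)} [IsProbabilityMeasure μ₀]
    [IsProbabilityMeasure μ₀']
    {κ κ' : (n : ℕ) → Kernel ((i : Finset.Iic n) → X i) (X (n + 1))} [∀ n, IsMarkovKernel (κ n)]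
    [∀ n, IsMarkovKernel (κ' n)] {δ : ENNReal} (h₀ : δ • μ₀' ≤ μ₀)
    (h : ∀ n x, δ • κ' n x ≤ κ n x) (n : ℕ) :
    δ ^ (n + 1) • (Kernel.trajMeasure μ₀' κ').map (Preorder.frestrictLe n) ≤
      (Kernel.trajMeasure μ₀ κ).map (Preorder.frestrictLe n) := by
  induction n with
  | zero =>
    obtain ⟨f, hf, -, hmap⟩ := exists_map_frestrictLe_zero_trajMeasure_eq (X := X)
    rw [hmap, hmap, zero_add, pow_one, ← Measure.map_smul]
    exact Measure.map_mono h₀ hf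
  | succ n ih =>
    set e : ((i : Finset.Iic n) → X i) × X (n + 1) → (i : Finset.Iic (n + 1)) → X i :=
      fun p => IicProdIoc n (n + 1) (p.1, MeasurableEquiv.piSingleton n p.2) with he
    have hem : Measurable e := by fun_prop
    have key : (Preorder.frestrictLe (π := X) (n + 1)) =
        e ∘ fun x : (i : ℕ) → X i => (Preorder.frestrictLe n x, x (n + 1)) := by
      funext x i
      by_cases hi : (i : ℕ) ≤ n
      · simp [he, IicProdIoc, hi]
      · obtain ⟨i, hi'⟩ := i
        obtain rfl : i = n + 1 := by
          have := Finset.mem_Iic.1 hi'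
          simp only at hi
          omega
        simp [he, IicProdIoc, MeasurableEquiv.piSingleton]
    rw [key, ← Measure.map_map hem (by fun_prop), ← Measure.map_map hem (by fun_prop),
      ← Kernel.map_frestrictLe_trajMeasure_compProd_eq_map_trajMeasure,
      ← Kernel.map_frestrictLe_trajMeasure_compProd_eq_map_trajMeasure, ← Measure.map_smul]
    refine Measure.map_mono (Measure.le_iff.2 fun S hS => ?_) hem
    have : IsProbabilityMeasure
        ((Kernel.trajMeasure μ₀ κ).map (Preorder.frestrictLe (π := X) n)) :=
      Measure.isProbabilityMeasure_map (by fun_prop)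
    have : IsProbabilityMeasure
        ((Kernel.trajMeasure μ₀' κ').map (Preorder.frestrictLe (π := X) n)) :=
      Measure.isProbabilityMeasure_map (by fun_prop)
    rw [Measure.smul_apply, Measure.compProd_apply hS, Measure.compProd_apply hS, pow_succ,
      smul_eq_mul, mul_assoc, ← lintegral_const_mul _ (Kernel.measurable_kernel_prodMk_left hS),
      ← smul_eq_mul, ← lintegral_smul_measure]
    -- One factor `δ` is absorbed by the kernel in the integrand, the other `n + 1` by the law of
    -- the past.
    exact lintegral_mono' ih fun x => h n x _

lemma ae_trajMeasure_mem {μ₀ : Measure (X 0)} [IsProbabilityMeasure μ₀]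
    {κ : (n : ℕ) → Kernel ((i : Finset.Iic n) → X i) (X (n + 1))} [∀ n, IsMarkovKernel (κ n)]
    {S : (n : ℕ) → Set (X n)} (hS : ∀ n, MeasurableSet (S n)) (h₀ : ∀ᵐ y ∂μ₀, y ∈ S 0)
    (h : ∀ n x, ∀ᵐ y ∂κ n x, y ∈ S (n + 1)) :
    ∀ᵐ ω ∂Kernel.trajMeasure μ₀ κ, ∀ n, ω n ∈ S n := by
  refine ae_all_iff.2 fun n => ?_
  cases n with
  | zero =>
    have h1 : ∀ᵐ x ∂(Kernel.trajMeasure μ₀ κ).map (Preorder.frestrictLe 0),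
        x ⟨0, by simp⟩ ∈ S 0 := by
      obtain ⟨f, hf, hf0, hmap⟩ := exists_map_frestrictLe_zero_trajMeasure_eq (X := X)
      rw [hmap]
      refine (ae_map_iff (p := fun x => x ⟨0, by simp⟩ ∈ S 0) hf.aemeasurable
        ((measurable_pi_apply (⟨0, by simp⟩ : Finset.Iic 0)) (hS 0))).2 ?_
      simpa only [hf0] using h₀
    exact ae_of_ae_map (f := Preorder.frestrictLe (π := X) 0) (by fun_prop) h1
  | succ n =>
    have : IsProbabilityMeasure
        ((Kernel.trajMeasure μ₀ κ).map (Preorder.frestrictLe (π := X) n)) :=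
      Measure.isProbabilityMeasure_map (by fun_prop)
    have h1 : ∀ᵐ p ∂((Kernel.trajMeasure μ₀ κ).map (Preorder.frestrictLe (π := X) n) ⊗ₘ κ n),
        p.2 ∈ S (n + 1) := by
      rw [Measure.ae_compProd_iff (measurable_snd (hS (n + 1)))]
      exact Filter.Eventually.of_forall fun x => h n x
    rw [Kernel.map_frestrictLe_trajMeasure_compProd_eq_map_trajMeasure] at h1
    exact ae_of_ae_map (f := fun x : (i : ℕ) → X i => (Preorder.frestrictLe n x, x (n + 1)))
      (by fun_prop) h1

end Trajectory

/-! ### Two instances dominating a common law cannot be told apart -/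

section Strategy

variable {K L : ℕ}

lemma exists_frestrictLe_preimage_of_measurableSet_history {n : ℕ} {A : Set (ℕ → Outcome L)}
    (hA : MeasurableSet[history L (n + 1)] A) :
    ∃ B, MeasurableSet B ∧ A = Preorder.frestrictLe (π := fun _ => Outcome L) n ⁻¹' B := by
  obtain ⟨B, hB, rfl⟩ := hA
  exact ⟨(fun h (s : Fin (n + 1)) =>
    h ⟨s, Finset.mem_Iic.2 (Nat.le_of_lt_succ s.isLt)⟩) ⁻¹' B,
    (by fun_prop : Measurable _) hB, rfl⟩

instance (ν : Fin K → Measure (Outcome L)) [∀ k, IsProbabilityMeasure (ν k)]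
    (s : Strategy K L) : IsProbabilityMeasure (trajLaw ν s) := by
  unfold trajLaw
  infer_instance

lemma pow_mul_trajLaw_le {ν ρ : Fin K → Measure (Outcome L)} [∀ k, IsProbabilityMeasure (ν k)]
    [∀ k, IsProbabilityMeasure (ρ k)] {δ : ENNReal} (h : ∀ k, δ • ρ k ≤ ν k) (s : Strategy K L)
    {n : ℕ} {A : Set (ℕ → Outcome L)} (hA : MeasurableSet[history L (n + 1)] A) :
    δ ^ (n + 1) * trajLaw ρ s A ≤ trajLaw ν s A := by
  obtain ⟨B, hB, rfl⟩ := exists_frestrictLe_preimage_of_measurableSet_history hA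
  have := trajMeasure_frestrictLe_le (X := fun _ => Outcome L) (κ := stepKernel ν s)
    (κ' := stepKernel ρ s) (h (s.arm 0 Fin.elim0)) (fun n x => h _) n B
  rwa [Measure.smul_apply, Measure.map_apply (by fun_prop) hB,
    Measure.map_apply (by fun_prop) hB] at this

lemma ae_trajLaw_mem {ν : Fin K → Measure (Outcome L)} [∀ k, IsProbabilityMeasure (ν k)]
    {S : Set (Outcome L)} (hS : MeasurableSet S) (h : ∀ k, ∀ᵐ y ∂ν k, y ∈ S)
    (s : Strategy K L) : ∀ᵐ ω ∂trajLaw ν s, ∀ n, ω n ∈ S :=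
  ae_trajMeasure_mem (X := fun _ => Outcome L) (S := fun _ => S) (fun _ => hS) (h _)
    fun _ _ => h _

/-- If two families of arm distributions dominate `δ` times a common family under which every pull
consumes at least one unit of resource `ℓ`, then a feasible strategy cannot identify both best
arms with high probability. -/
lemma pow_le_failProb_add_failProb {ν ν' ρ : Fin K → Measure (Outcome L)}
    [∀ k, IsProbabilityMeasure (ν k)] [∀ k, IsProbabilityMeasure (ν' k)]
    [∀ k, IsProbabilityMeasure (ρ k)] {δ : ℝ} (hδ : 0 < δ)
    (h : ∀ k, ENNReal.ofReal δ • ρ k ≤ ν k) (h' : ∀ k, ENNReal.ofReal δ • ρ k ≤ ν' k)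
    {ℓ : Fin L} (hν : ∀ k, ∀ᵐ y ∂ν k, 0 ≤ y.2 ℓ) (hρ : ∀ k, ∀ᵐ y ∂ρ k, 1 ≤ y.2 ℓ)
    {C : Fin L → ℝ} {s : Strategy K L} (hs : Feasible ν C s) {j j' : Fin K} (hj : j ≠ j') :
    δ ^ (⌊C ℓ⌋₊ + 1) ≤ failProb ν s j + failProb ν' s j' := by
  set n := ⌊C ℓ⌋₊
  -- `T` and `E` both concern only the first `n + 1` outcomes, so domination costs exactly `δ ^ (n +
  -- 1)`. Since `n + 1 > C ℓ`, a run in `E` that goes beyond `T` exceeds the budget.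
  set T : Set (ℕ → Outcome L) := {ω | s.tau ω ≤ ((n + 1 : ℕ) : WithTop ℕ)} with hT
  have hTm : MeasurableSet[history L (n + 1)] T := s.isStoppingTime_tau (n + 1)
  set E : Set (ℕ → Outcome L) := {ω | ∀ t : Fin (n + 1), 1 ≤ (ω t).2 ℓ} with hE
  have hEm : MeasurableSet[history L (n + 1)] E :=
    ⟨{v | ∀ t, 1 ≤ (v t).2 ℓ}, by
      simp only [Set.ofPred_forall]
      exact MeasurableSet.iInter fun t => measurableSet_le measurable_const (by fun_prop), rfl⟩
  have hρE : ∀ᵐ ω ∂trajLaw ρ s, ω ∈ E := by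
    filter_upwards [ae_trajLaw_mem (S := {y | 1 ≤ y.2 ℓ})
      (measurableSet_le measurable_const (by fun_prop)) hρ s] with ω hω t using hω t
  have hνE : trajLaw ν s (E ∩ Tᶜ) = 0 := by
    have hnn := ae_trajLaw_mem (S := {y | 0 ≤ y.2 ℓ})
      (measurableSet_le measurable_const (by fun_prop)) hν s
    refine measure_mono_null ?_ ((ae_iff.1 (hnn.and hs)))
    rintro ω ⟨hωE, hωT⟩ ⟨hω, m, hm, hC⟩
    have hnm : n + 1 < m := by
      have : ¬ s.tau ω ≤ ((n + 1 : ℕ) : WithTop ℕ) := hωT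
      rw [hm] at this
      exact WithTop.coe_lt_coe.1 (not_le.1 this)
    have h1 : ((n + 1 : ℕ) : ℝ) ≤ ∑ t ∈ Finset.range (n + 1), (ω t).2 ℓ := by
      have := Finset.card_nsmul_le_sum (Finset.range (n + 1)) (fun t => (ω t).2 ℓ) 1
        fun t ht => hωE ⟨t, Finset.mem_range.1 ht⟩
      simpa using this
    have h2 : ∑ t ∈ Finset.range (n + 1), (ω t).2 ℓ ≤ ∑ t ∈ Finset.range m, (ω t).2 ℓ :=
      Finset.sum_le_sum_of_subset_of_nonneg (Finset.range_subset_range.2 hnm.le)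
        fun t _ _ => hω t
    have h3 : C ℓ < n + 1 := Nat.lt_floor_add_one _
    push_cast at h1
    linarith [hC ℓ]
  have hδ' : ENNReal.ofReal δ ^ (n + 1) ≠ 0 := by
    simp [hδ]
  -- Feasibility passes from `ν` to `ρ`: a `ν`-null event of the first `n + 1` outcomes is `ρ`-null
  -- because `δ > 0`, and `E` has full measure under `ρ`.
  have hρT : trajLaw ρ s Tᶜ = 0 := by
    have h1 : trajLaw ρ s (E ∩ Tᶜ) = 0 := by
      have := pow_mul_trajLaw_le h s (hEm.inter hTm.compl)
      rw [hνE, nonpos_iff_eq_zero, mul_eq_zero] at this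
      exact this.resolve_left hδ'
    rw [← h1]
    refine measure_congr ?_
    filter_upwards [hρE] with ω hω
    exact propext ⟨fun hh => ⟨hω, hh⟩, fun hh => hh.2⟩
  have hguess : ∀ D : Set (Fin K), MeasurableSet[history L (n + 1)] (s.guess ⁻¹' D ∩ T) :=
    fun D => (s.measurable_guess (MeasurableSet.of_discrete (s := D))).2 (n + 1)
  have hle := (history L).le (n + 1)
  have key : ENNReal.ofReal δ ^ (n + 1) ≤
      trajLaw ν s {ω | s.guess ω ≠ j} + trajLaw ν' s {ω | s.guess ω ≠ j'} := by
    -- Under `ρ` the run is almost surely in `T`, where the guess either differs from `j` or equals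
    -- `j`, hence differs from `j'`.
    have hsum : 1 ≤ trajLaw ρ s (s.guess ⁻¹' {j}ᶜ ∩ T) + trajLaw ρ s (s.guess ⁻¹' {j} ∩ T) := by
      calc (1 : ENNReal) = trajLaw ρ s Set.univ := measure_univ.symm
        _ ≤ trajLaw ρ s ((s.guess ⁻¹' {j}ᶜ ∩ T) ∪ (s.guess ⁻¹' {j} ∩ T) ∪ Tᶜ) := by
          refine measure_mono fun ω _ => ?_
          by_cases h1 : ω ∈ T <;> by_cases h2 : s.guess ω = j <;> simp [h1, h2]
        _ ≤ _ := by
          refine (measure_union_le _ _).trans ?_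
          rw [hρT, add_zero]
          exact measure_union_le _ _
    calc ENNReal.ofReal δ ^ (n + 1)
        ≤ ENNReal.ofReal δ ^ (n + 1) *
          (trajLaw ρ s (s.guess ⁻¹' {j}ᶜ ∩ T) + trajLaw ρ s (s.guess ⁻¹' {j} ∩ T)) :=
          le_mul_of_one_le_right zero_le hsum
      _ ≤ trajLaw ν s (s.guess ⁻¹' {j}ᶜ ∩ T) + trajLaw ν' s (s.guess ⁻¹' {j} ∩ T) := by
          rw [mul_add]
          exact add_le_add (pow_mul_trajLaw_le h s (hguess _))
            (pow_mul_trajLaw_le h' s (hguess _))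
      _ ≤ _ := by
          refine add_le_add (measure_mono fun ω hω => hω.1) (measure_mono fun ω hω => ?_)
          have : s.guess ω = j := hω.1
          simpa [this] using hj
  rw [← ENNReal.ofReal_pow hδ.le, ENNReal.ofReal_le_iff_le_toReal (by finiteness),
    ENNReal.toReal_add (by finiteness) (by finiteness)] at key
  exact key

end Strategy

/-! ### The common lower bound for the instances -/

section InstanceLaw

/-- A lower bound of the density of `N(a, 1)` on `[0, 1]`, for `a` in `[0, 1]`. -/
noncomputable def gaussianOverlap : ℝ := (√(2 * Real.pi))⁻¹ * Real.exp (-(1 / 2))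

lemma gaussianOverlap_pos : 0 < gaussianOverlap := by
  unfold gaussianOverlap
  positivity

lemma gaussianOverlap_smul_le {a : ℝ} (ha : a ∈ I) :
    ENNReal.ofReal gaussianOverlap • volume.restrict I ≤ gaussianReal a 1 := by
  rw [gaussianReal_of_var_ne_zero _ one_ne_zero, ← withDensity_const]
  refine Measure.le_iff.2 fun S hS => ?_
  rw [withDensity_apply _ hS, withDensity_apply _ hS, Measure.restrict_restrict hS]
  refine (setLIntegral_mono (measurable_gaussianPDF a 1) fun x hx => ?_).trans
    (lintegral_mono_set Set.inter_subset_left)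
  refine ENNReal.ofReal_le_ofReal ?_
  rw [gaussianPDFReal_def, gaussianOverlap]
  simp only [NNReal.coe_one, mul_one]
  gcongr
  obtain ⟨-, hx0, hx1⟩ := hx
  obtain ⟨ha0, ha1⟩ := ha
  -- Both points lie in `[0, 1]`, so `(x - a) ^ 2 ≤ 1`.
  nlinarith

variable {N L : ℕ}

lemma pi_bernoulliMeasure_eval_eq_one (p : Fin L → I) (ℓ : Fin L) :
    (Measure.pi fun ℓ => bernoulliMeasure (1 : ℝ) 0 (p ℓ)) {x | x ℓ = 1} =
      ENNReal.ofReal (p ℓ) := by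
  classical
  have h := (measurePreserving_eval (fun ℓ => bernoulliMeasure (1 : ℝ) 0 (p ℓ)) ℓ).measure_preimage
    (measurableSet_singleton (1 : ℝ)).nullMeasurableSet
  refine (h : _ = _).trans ?_
  rw [bernoulliMeasure_apply _ (measurableSet_singleton _)]
  simp only [Set.mem_singleton_iff, if_true, zero_ne_one, if_false]
  rw [← ENNReal.ofReal_coe_nnreal]
  rfl

lemma ae_instanceLaw_nonneg (r : Fin (N + 2) → ℝ) (d : Fin L → Fin (N + 2) → I)
    (j k : Fin (N + 2)) (ℓ : Fin L) : ∀ᵐ y ∂instanceLaw r d j k, 0 ≤ y.2 ℓ := by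
  classical
  set b := fun ℓ => bernoulliMeasure (1 : ℝ) 0 (meanConsumption (d ℓ) k) with hb
  have h0 : ∀ᵐ x ∂b ℓ, 0 ≤ x := by
    rw [ae_iff, hb, bernoulliMeasure_apply _ (by measurability)]
    simp
  have h1 : ∀ᵐ x ∂Measure.pi b, 0 ≤ x ℓ :=
    (measurePreserving_eval b ℓ).quasiMeasurePreserving.ae h0
  exact Measure.quasiMeasurePreserving_snd.ae h1

lemma meanReward_mem_unitInterval {r : Fin (N + 2) → ℝ} (hr : ∀ k, r k ∈ I) (j k : Fin (N + 2)) :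
    meanReward r j k ∈ I := by
  obtain ⟨h0, h1⟩ := hr k
  unfold meanReward
  split_ifs
  · exact ⟨by linarith, by linarith⟩
  · exact hr k

lemma le_meanConsumption {d : Fin (N + 2) → I} {q : ℝ} (h : ∀ k, q ≤ d k) (k : Fin (N + 2)) :
    q ≤ meanConsumption d k := by
  unfold meanConsumption
  split_ifs <;> exact h _

/-- The arm distributions with a reward uniform on `[0, 1]`, conditioned on consuming one unit of
resource `ℓ`. -/
noncomputable def fullConsumptionLaw (d : Fin L → Fin (N + 2) → I) (ℓ : Fin L) (k : Fin (N + 2)) :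
    Measure (Outcome L) :=
  (volume.restrict I).prod
    (ProbabilityTheory.cond
      (Measure.pi fun ℓ => bernoulliMeasure (1 : ℝ) 0 (meanConsumption (d ℓ) k)) {x | x ℓ = 1})

lemma measurableSet_eval_eq_one (ℓ : Fin L) : MeasurableSet {x : Fin L → ℝ | x ℓ = 1} :=
  measurable_pi_apply ℓ (measurableSet_singleton 1)

lemma isProbabilityMeasure_fullConsumptionLaw {d : Fin L → Fin (N + 2) → I} {ℓ : Fin L}
    {q : ℝ} (hq : 0 < q) (hd : ∀ k, q ≤ d ℓ k) (k : Fin (N + 2)) :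
    IsProbabilityMeasure (fullConsumptionLaw d ℓ k) := by
  have : IsProbabilityMeasure (volume.restrict I : Measure ℝ) := ⟨by simp [unitInterval]⟩
  have := cond_isProbabilityMeasure
    (μ := Measure.pi fun ℓ => bernoulliMeasure (1 : ℝ) 0 (meanConsumption (d ℓ) k))
    (s := {x | x ℓ = 1}) (by
      rw [pi_bernoulliMeasure_eval_eq_one]
      simpa using hq.trans_le (le_meanConsumption hd k))
  unfold fullConsumptionLaw
  infer_instance

lemma ae_fullConsumptionLaw (d : Fin L → Fin (N + 2) → I) (ℓ : Fin L) (k : Fin (N + 2)) :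
    ∀ᵐ y ∂fullConsumptionLaw d ℓ k, 1 ≤ y.2 ℓ := by
  refine Measure.quasiMeasurePreserving_snd.ae (p := fun x : Fin L → ℝ => 1 ≤ x ℓ) ?_
  filter_upwards [ae_cond_mem (measurableSet_eval_eq_one ℓ)] with x hx using
    (show x ℓ = 1 from hx).ge

/-- The left side is independent of `j`: instances differ only in mean rewards, all in `[0, 1]`,
where the Gaussian densities share the bound `gaussianOverlap`. Conditioning on an event of mass at
least `q` multiplies the measure by at most `1 / q`. -/
lemma smul_fullConsumptionLaw_le {r : Fin (N + 2) → ℝ} (hr : ∀ k, r k ∈ I)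
    {d : Fin L → Fin (N + 2) → I} {ℓ : Fin L} {q : ℝ} (hd : ∀ k, q ≤ d ℓ k) (j k : Fin (N + 2)) :
    ENNReal.ofReal (gaussianOverlap * q) • fullConsumptionLaw d ℓ k ≤ instanceLaw r d j k := by
  set μ := Measure.pi fun ℓ => bernoulliMeasure (1 : ℝ) 0 (meanConsumption (d ℓ) k) with hμ
  have hμ1 : ENNReal.ofReal q ≤ μ {x | x ℓ = 1} := by
    rw [hμ, pi_bernoulliMeasure_eval_eq_one]
    exact ENNReal.ofReal_le_ofReal (le_meanConsumption hd k)
  have h : ENNReal.ofReal q • ProbabilityTheory.cond μ {x | x ℓ = 1} ≤ μ := by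
    rw [ProbabilityTheory.cond, smul_smul]
    refine Measure.le_iff.2 fun S hS => ?_
    rw [Measure.smul_apply, smul_eq_mul]
    refine (mul_le_of_le_one_left zero_le ?_).trans (Measure.restrict_apply_le _ _)
    rw [← div_eq_mul_inv]
    exact ENNReal.div_le_of_le_mul (by rwa [one_mul])
  rw [ENNReal.ofReal_mul gaussianOverlap_pos.le, ← smul_smul, fullConsumptionLaw,
    ← Measure.prod_smul_right, ← Measure.prod_smul_left]
  exact Measure.prod_mono (gaussianOverlap_smul_le (meanReward_mem_unitInterval hr j k)) h

/-- Every feasible strategy fails with probability at least of order `q ^ C ℓ`, where `q` is a lower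
bound of the mean consumptions of resource `ℓ`. -/
lemma pow_le_two_mul_max_failProb {r : Fin (N + 2) → ℝ} (hr : ∀ k, r k ∈ I)
    {d : Fin L → Fin (N + 2) → I} {ℓ : Fin L} {q : ℝ} (hq : 0 < q) (hd : ∀ k, q ≤ d ℓ k)
    {C : Fin L → ℝ} {s : Strategy (N + 2) L} {j j' : Fin (N + 2)} (hjj : j ≠ j')
    (hs : Feasible (instanceLaw r d j) C s) :
    (gaussianOverlap * q) ^ (⌊C ℓ⌋₊ + 1) ≤
      2 * max (failProb (instanceLaw r d j) s j) (failProb (instanceLaw r d j') s j') := by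
  have := isProbabilityMeasure_fullConsumptionLaw hq hd
  have h := pow_le_failProb_add_failProb (mul_pos gaussianOverlap_pos hq)
    (smul_fullConsumptionLaw_le hr hd j) (smul_fullConsumptionLaw_le hr hd j')
    (fun k => ae_instanceLaw_nonneg r d j k ℓ) (ae_fullConsumptionLaw d ℓ) hs hjj
  linarith [le_max_left (failProb (instanceLaw r d j) s j) (failProb (instanceLaw r d j') s j'),
    le_max_right (failProb (instanceLaw r d j) s j) (failProb (instanceLaw r d j') s j')]

end InstanceLaw

/-! ### Comparison with the complexity `γ̃` as `c → 0` -/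

section Asymptotics

open Filter Topology

variable {N L : ℕ}

lemma complexityH_pos {g : ℝ → ℝ} {r : Fin (N + 2) → ℝ} (hr_gap : r 1 < r 0)
    {d : Fin (N + 2) → I} (hg : ∀ k, 0 < g (d k)) : 0 < complexityH g r d := by
  have h : (0 : ℝ) < (∑ j ∈ Finset.Iic (0 : Fin (N + 1)).succ, g (d j)) /
      (r 0 - r (0 : Fin (N + 1)).succ) ^ 2 := by
    refine div_pos (Finset.sum_pos (fun j _ => hg j) ⟨0, by simp⟩) (pow_pos ?_ 2)
    simpa using hr_gap
  exact h.trans_le (Finset.le_sup'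
    (fun m : Fin (N + 1) => (∑ j ∈ Finset.Iic m.succ, g (d j)) / (r 0 - r m.succ) ^ 2)
    (Finset.mem_univ 0))

lemma complexityH_le {g : ℝ → ℝ} {r : Fin (N + 2) → ℝ} (hr_gap : r 1 < r 0) (hr : Antitone r)
    {d : Fin (N + 2) → I} (hg : ∀ k, 0 < g (d k)) {η : ℝ} (hη : ∀ k, g (d k) ≤ η) :
    complexityH g r d ≤ (N + 2) * η / (r 0 - r 1) ^ 2 := by
  refine Finset.sup'_le _ _ fun m _ => ?_
  have h1 : r m.succ ≤ r 1 := hr (by simp [Fin.le_def])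
  refine div_le_div₀ ?_ ?_ (pow_pos (by linarith) 2)
    (pow_le_pow_left₀ (by linarith) (by linarith) 2)
  · have := (hg 0).trans_le (hη 0)
    positivity
  · calc ∑ j ∈ Finset.Iic m.succ, g (d j) ≤ ∑ j, g (d j) :=
        Finset.sum_le_sum_of_subset_of_nonneg (Finset.subset_univ _) fun j _ _ => (hg j).le
      _ ≤ ∑ _j : Fin (N + 2), η := Finset.sum_le_sum fun j _ => hη j
      _ = (N + 2) * η := by simp

lemma tendsto_log_one_div_nhdsGT_zero :
    Tendsto (fun d : ℝ => Real.log (1 / d)) (𝓝[>] 0) atTop := by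
  simp only [one_div, Real.log_inv]
  exact tendsto_neg_atBot_atTop.comp Real.tendsto_log_nhdsGT_zero

lemma tendsto_const_mul_nhdsGT_zero {a : ℝ} (ha : 0 < a) :
    Tendsto (fun c : ℝ => c * a) (𝓝[>] 0) (𝓝[>] 0) := by
  refine tendsto_nhdsWithin_iff.2 ⟨?_, ?_⟩
  · have : Tendsto (fun c : ℝ => c * a) (𝓝 0) (𝓝 0) := by
      simpa using (continuous_mul_const a).tendsto (0 : ℝ)
    exact this.mono_left nhdsWithin_le_nhds
  · filter_upwards [self_mem_nhdsWithin] with c hc using mul_pos hc ha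

/-- If `g d * log (1 / d) → 0`, then the effective consumptions `g (c * a)` are eventually
negligible with respect to `1 / log (1 / c)`. -/
lemma eventually_mul_log_le {g : ℝ → ℝ} (hg : ∀ᶠ d in 𝓝[>] (0 : ℝ), 0 < g d)
    (hlim : Tendsto (fun d => g d * Real.log (1 / d)) (𝓝[>] 0) (𝓝 0)) {a η : ℝ} (ha : 0 < a)
    (hη : 0 < η) (κ : ℝ) :
    ∀ᶠ c in 𝓝[>] (0 : ℝ), 0 < g (c * a) ∧ 0 < κ + Real.log (1 / c) ∧
      g (c * a) * (κ + Real.log (1 / c)) ≤ η := by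
  have hlog := tendsto_log_one_div_nhdsGT_zero
  have ht := tendsto_const_mul_nhdsGT_zero ha
  -- The threshold `κ + 2 * log a` gives `κ + log (1 / c) ≤ 2 * log (1 / (c * a))`; hence the bound
  -- `η / 2` on the limit.
  filter_upwards [ht.eventually hg, (ht.eventually (hlim.eventually_lt_const (half_pos hη))),
    hlog.eventually_gt_atTop (κ + 2 * Real.log a), hlog.eventually_gt_atTop (-κ),
    self_mem_nhdsWithin] with c h1 h2 h3 h4 hc
  have hc : 0 < c := hc
  refine ⟨h1, by linarith, ?_⟩
  have h5 : Real.log (1 / (c * a)) = Real.log (1 / c) - Real.log a := by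
    rw [one_div, one_div, Real.log_inv, Real.log_inv, Real.log_mul hc.ne' ha.ne']
    ring
  rw [h5] at h2
  nlinarith

/-- A lower bound on the failure probability that beats every exponential rate in `γ̃`, for an
effective consumption that vanishes faster than `1 / log (1 / d)`. -/
lemma lt_max_failProb_of_tendsto [NeZero L] {r : Fin (N + 2) → ℝ} (hr_mem : ∀ k, r k ∈ I)
    (hr_gap : r 1 < r 0) (hr_anti : Antitone r) {d0 : Fin L → Fin (N + 2) → ℝ}
    (hd0 : ∀ ℓ k, 0 < d0 ℓ k) {i : Fin (N + 2)} (hi : i ≠ 0) {g : ℝ → ℝ}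
    (hg : ∀ᶠ d in 𝓝[>] (0 : ℝ), 0 < g d)
    (hlim : Tendsto (fun d => g d * Real.log (1 / d)) (𝓝[>] 0) (𝓝 0)) {A B : ℝ} (hA : 0 < A)
    (hB : 0 < B) :
    ∃ cbar : ℝ, 0 < cbar ∧ cbar < 1 ∧ ∀ c : ℝ, 0 < c → c < cbar →
      ∃ hc : ∀ ℓ k, c * d0 ℓ k ∈ I,
      ∃ Cbar : ℝ, ∀ C : Fin L → ℝ, (∀ ℓ, Cbar ≤ C ℓ) →
      ∀ s : Strategy (N + 2) L,
        (∀ j, j = 0 ∨ j = i → Feasible (instanceLaw r (scaled c d0 hc) j) C s) →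
        A * Real.exp (-B * complexityGamma g r (scaled c d0 hc) C) <
          max (failProb (instanceLaw r (scaled c d0 hc) 0) s 0)
            (failProb (instanceLaw r (scaled c d0 hc) i) s i) := by
  obtain ⟨p, hp⟩ := Finite.exists_min fun p : Fin L × Fin (N + 2) => d0 p.1 p.2
  set q := d0 p.1 p.2
  have hq : 0 < q := hd0 _ _
  have hΔ : 0 < r 0 - r 1 := by linarith
  -- With this `κ`, `κ + log (1 / c) = -log δ + 1` for `δ = gaussianOverlap * (c * q)`. The extra
  -- `1` is the slack that will absorb `A`, the factor `2` and the rounding of `C ℓ`.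
  set κ := -Real.log (gaussianOverlap * q) + 1
  have hev : ∀ᶠ c in 𝓝[>] (0 : ℝ), ∀ p : Fin L × Fin (N + 2),
      (0 < g (c * d0 p.1 p.2) ∧ 0 < κ + Real.log (1 / c) ∧
        -- The right side inverts the bound of `complexityH_le`, so that `H̃ ≤ B / (lam + 1)`.
        g (c * d0 p.1 p.2) * (κ + Real.log (1 / c)) ≤ B * (r 0 - r 1) ^ 2 / (N + 2)) ∧
        c * d0 p.1 p.2 ≤ 1 := by
    refine eventually_all.2 fun p => (eventually_mul_log_le hg hlim (hd0 _ _) (by positivity) κ).and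
      ?_
    have := (tendsto_const_mul_nhdsGT_zero (hd0 p.1 p.2)).mono_right nhdsWithin_le_nhds
    exact this.eventually_le_const one_pos
  obtain ⟨u, hu, hev⟩ := mem_nhdsGT_iff_exists_Ioo_subset.1 hev
  refine ⟨min u (1 / 2), lt_min hu (by norm_num), (min_le_right _ _).trans_lt (by norm_num),
    fun c hc0 hcu => ?_⟩
  have hev := hev ⟨hc0, hcu.trans_le (min_le_left _ _)⟩
  have hc : ∀ ℓ k, c * d0 ℓ k ∈ I := fun ℓ k =>
    ⟨(mul_pos hc0 (hd0 ℓ k)).le, (hev (ℓ, k)).2⟩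
  have hκ : 0 < κ + Real.log (1 / c) := (hev p).1.2.1
  set lam := κ + Real.log (1 / c) - 1 with hlam
  have hδ : gaussianOverlap * (c * q) = Real.exp (-lam) := by
    have h1 : -lam = Real.log (gaussianOverlap * q) + Real.log c := by
      simp only [hlam, κ, one_div, Real.log_inv]
      ring
    have := gaussianOverlap_pos
    rw [h1, Real.exp_add, Real.exp_log (by positivity), Real.exp_log hc0]
    ring
  refine ⟨hc, max 1 (Real.log (2 * A) + |lam| + 1), fun C hC s hs => ?_⟩
  -- The argument is run on the resource that attains the minimum in `γ̃`.
  obtain ⟨ℓ, -, hℓ⟩ := Finset.exists_mem_eq_inf' Finset.univ_nonempty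
    fun ℓ : Fin L => C ℓ / complexityH g r (scaled c d0 hc ℓ)
  have hC1 : 1 ≤ C ℓ := (le_max_left _ _).trans (hC ℓ)
  have hC2 : Real.log (2 * A) + |lam| < C ℓ := by
    linarith [(le_max_right _ _).trans (hC ℓ)]
  have hgpos : ∀ k, 0 < g (scaled c d0 hc ℓ k) := fun k => (hev (ℓ, k)).1.1
  have hHpos := complexityH_pos hr_gap hgpos
  have hH : complexityH g r (scaled c d0 hc ℓ) ≤ B / (lam + 1) := by
    refine (complexityH_le hr_gap hr_anti hgpos
      (η := B * (r 0 - r 1) ^ 2 / (N + 2) / (lam + 1)) fun k => ?_).trans_eq ?_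
    · rw [le_div_iff₀ (by linarith), hlam, sub_add_cancel]
      exact (hev (ℓ, k)).1.2.2
    · field_simp
  have hγ : (lam + 1) * C ℓ ≤ B * complexityGamma g r (scaled c d0 hc) C := by
    rw [complexityGamma, hℓ, ← mul_div_assoc, le_div_iff₀ hHpos]
    rw [le_div_iff₀ (by linarith)] at hH
    nlinarith
  have hfail := pow_le_two_mul_max_failProb hr_mem (mul_pos hc0 hq)
    (d := scaled c d0 hc) (ℓ := ℓ) (C := C) (s := s)
    (fun k => mul_le_mul_of_nonneg_left (hp (ℓ, k)) hc0.le) hi.symm (hs 0 (Or.inl rfl))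
  rw [hδ, ← Real.exp_nat_mul] at hfail
  -- Here `B γ̃ ≥ (lam + 1) * C ℓ`, while `(⌊C ℓ⌋₊ + 1) * lam ≤ C ℓ * lam + |lam|` whatever the sign
  -- of `lam`; the difference is at least `C ℓ - |lam|`, which exceeds `log (2 * A)`.
  have hexp : Real.log (2 * A) - B * complexityGamma g r (scaled c d0 hc) C <
      ((⌊C ℓ⌋₊ + 1 : ℕ) : ℝ) * -lam := by
    have hf : (⌊C ℓ⌋₊ : ℝ) ≤ C ℓ := Nat.floor_le (by linarith)
    have hf' : C ℓ < ⌊C ℓ⌋₊ + 1 := Nat.lt_floor_add_one _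
    push_cast
    have : (⌊C ℓ⌋₊ + 1 - C ℓ) * lam ≤ |lam| :=
      calc (⌊C ℓ⌋₊ + 1 - C ℓ) * lam ≤ (⌊C ℓ⌋₊ + 1 - C ℓ) * |lam| :=
            mul_le_mul_of_nonneg_left (le_abs_self _) (by linarith)
        _ ≤ |lam| := mul_le_of_le_one_left (abs_nonneg _) (by linarith)
    nlinarith
  have := (Real.exp_lt_exp.2 hexp).trans_le hfail
  rw [sub_eq_add_neg, Real.exp_add, Real.exp_log (by positivity), ← neg_mul] at this
  linarith

/-- Because `1 / 0 = 0`, divergence also rules out `g d = 0` near zero. -/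
lemma eventually_pos_of_tendsto_one_div {g : ℝ → ℝ}
    (h : Tendsto (fun d : ℝ => 1 / (g d * Real.log (1 / d))) (𝓝[>] 0) atTop) :
    ∀ᶠ d in 𝓝[>] (0 : ℝ), 0 < g d := by
  filter_upwards [h.eventually_gt_atTop 0, tendsto_log_one_div_nhdsGT_zero.eventually_gt_atTop 0]
    with d h1 h2
  exact pos_of_mul_pos_left (one_div_pos.1 h1) h2.le

lemma tendsto_mul_log_of_tendsto_one_div {g : ℝ → ℝ}
    (h : Tendsto (fun d : ℝ => 1 / (g d * Real.log (1 / d))) (𝓝[>] 0) atTop) :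
    Tendsto (fun d => g d * Real.log (1 / d)) (𝓝[>] 0) (𝓝 0) := by
  refine h.inv_tendsto_atTop.congr fun d => ?_
  rw [Pi.inv_apply, one_div, inv_inv]

lemma tendsto_mul_log_one_div : Tendsto (fun d : ℝ => d * Real.log (1 / d)) (𝓝[>] 0) (𝓝 0) := by
  have h := (tendsto_log_mul_rpow_nhdsGT_zero one_pos).neg
  simp only [Real.rpow_one, neg_zero] at h
  refine h.congr fun d => ?_
  rw [one_div, Real.log_inv]
  ring

lemma tendsto_log_rpow_mul_log_one_div {ε : ℝ} (hε : 0 < ε) :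
    Tendsto (fun d : ℝ => Real.log (1 / d) ^ (-1 - ε) * Real.log (1 / d)) (𝓝[>] 0) (𝓝 0) := by
  refine ((tendsto_rpow_neg_atTop hε).comp tendsto_log_one_div_nhdsGT_zero).congr' ?_
  filter_upwards [tendsto_log_one_div_nhdsGT_zero.eventually_gt_atTop 0] with d hd
  rw [Function.comp, ← Real.rpow_add_one hd.ne']
  ring_nf

end Asymptotics

end BAIwRC

theorem theorem4 (N L : ℕ) [NeZero L]
    (r : Fin (N + 2) → ℝ) (hr_first : r 0 = 1 / 2) (hr_gap : r 1 < r 0)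
    (hr_anti : Antitone r) (hr_last : r (Fin.last (N + 1)) = 1 / 4)
    (d0 : Fin L → Fin (N + 2) → ℝ) (hd0_pos : ∀ ℓ k, 0 < d0 ℓ k)
    (hd0_anti : ∀ ℓ, Antitone (d0 ℓ))
    (i : Fin (N + 2)) (hi : i ≠ 0) :
    (∀ g : ℝ → ℝ, MonotoneOn g (Set.Ici 0) → g 0 = 0 →
      Filter.Tendsto (fun d : ℝ => 1 / (g d * Real.log (1 / d)))
        (nhdsWithin 0 (Set.Ioi 0)) Filter.atTop →
      ∃ cbar : ℝ, 0 < cbar ∧ cbar < 1 ∧ ∀ c : ℝ, 0 < c → c < cbar →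
        ∃ hc : ∀ ℓ k, c * d0 ℓ k ∈ unitInterval,
        ∃ Cbar : ℝ, ∀ C : Fin L → ℝ, (∀ ℓ, Cbar ≤ C ℓ) →
        ∀ s : BAIwRC.Strategy (N + 2) L,
          (∀ j, j = 0 ∨ j = i →
            BAIwRC.Feasible (BAIwRC.instanceLaw r (BAIwRC.scaled c d0 hc) j) C s) →
          Real.exp (-2 * BAIwRC.complexityGamma g r (BAIwRC.scaled c d0 hc) C) ≤
            max (BAIwRC.failProb (BAIwRC.instanceLaw r (BAIwRC.scaled c d0 hc) 0) s 0)
              (BAIwRC.failProb (BAIwRC.instanceLaw r (BAIwRC.scaled c d0 hc) i) s i)) ∧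
    (∀ g : ℝ → ℝ,
      ((g = fun d => d) ∨
        ∃ ε : ℝ, 0 < ε ∧ g = fun d => (Real.log (1 / d)) ^ (-1 - ε)) →
      ∀ A B : ℝ, 0 < A → 0 < B →
      ∃ cbar : ℝ, 0 < cbar ∧ cbar < 1 ∧ ∀ c : ℝ, 0 < c → c < cbar →
        ∃ hc : ∀ ℓ k, c * d0 ℓ k ∈ unitInterval,
        ∃ Cbar : ℝ, ∀ C : Fin L → ℝ, (∀ ℓ, Cbar ≤ C ℓ) →
        ∀ s : BAIwRC.Strategy (N + 2) L,
          (∀ j, j = 0 ∨ j = i →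
            BAIwRC.Feasible (BAIwRC.instanceLaw r (BAIwRC.scaled c d0 hc) j) C s) →
          A * Real.exp (-B * BAIwRC.complexityGamma g r (BAIwRC.scaled c d0 hc) C) <
            max (BAIwRC.failProb (BAIwRC.instanceLaw r (BAIwRC.scaled c d0 hc) 0) s 0)
              (BAIwRC.failProb (BAIwRC.instanceLaw r (BAIwRC.scaled c d0 hc) i) s i)) := by
  have hr_mem : ∀ k, r k ∈ unitInterval := fun k =>
    ⟨by linarith [hr_anti (Fin.le_last k)], by linarith [hr_anti (Fin.zero_le k)]⟩
  refine ⟨fun g _ _ hlim => ?_, fun g hg A B hA hB => ?_⟩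
  -- Part (1) is the case `A = 1`, `B = 2`.
  · obtain ⟨cbar, h0, h1, H⟩ := BAIwRC.lt_max_failProb_of_tendsto hr_mem hr_gap hr_anti hd0_pos hi
      (BAIwRC.eventually_pos_of_tendsto_one_div hlim)
      (BAIwRC.tendsto_mul_log_of_tendsto_one_div hlim) one_pos two_pos
    refine ⟨cbar, h0, h1, fun c hc0 hc1 => ?_⟩
    obtain ⟨hc, Cbar, H⟩ := H c hc0 hc1
    refine ⟨hc, Cbar, fun C hC s hs => ?_⟩
    have := H C hC s hs
    rw [one_mul] at this
    exact this.le
  · obtain rfl | ⟨ε, hε, rfl⟩ := hg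
    · exact BAIwRC.lt_max_failProb_of_tendsto hr_mem hr_gap hr_anti hd0_pos hi
        self_mem_nhdsWithin BAIwRC.tendsto_mul_log_one_div hA hB
    · refine BAIwRC.lt_max_failProb_of_tendsto hr_mem hr_gap hr_anti hd0_pos hi ?_
        (BAIwRC.tendsto_log_rpow_mul_log_one_div hε) hA hB
      filter_upwards [BAIwRC.tendsto_log_one_div_nhdsGT_zero.eventually_gt_atTop 0] with d hd
      exact Real.rpow_pos_of_pos hd _
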